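/- Consider a single-tier cellular network with user density $\lambda^{(u)}>0$, base-station density $\lambda^{(b)}>0$, transmit power $P>0$, path-loss exponent $\alpha>2$, positive shadowing power gain $\chi$ with $\mathbb{E}\{\chi^{2/\alpha}\}<\infty$, no noise (interference-limited), and Rayleigh fading, i.e. the fading power gain $H$ is exponential with mean one. Put $$\lambda_s=\lambda^{(b)}\,\mathbb{E}\{\chi^{2/\alpha}\},\qquad \overline{\varphi}=1-e^{-\lambda^{(u)}/\lambda_s}\in(0,1).$$ Let ${}_2F_1$ be the Gauss hypergeometric function, continued analytically to $(-\infty,1)$. The average rate bound is $$\tilde{\mathcal R}=\log_2(e)\int_0^{\infty}\!\!\int_0^{\infty}\tilde{\mathcal M}(z\mid R)\,\bigl[1-\mathcal M(z\mid R)\bigr]\,\frac1z\;2\pi\lambda_s R\,e^{-\pi\lambda_s R^2}\,dz\,dR,$$ where $\mathcal M(z\mid R)=\mathbb{E}_H\{e^{-zPHR^{-\alpha}}\}$ is the conditional MGF of the received signal power, and $\tilde{\mathcal M}(z\mid R)=e^{-\pi\lambda_s\mathcal A}$ is the bound of the conditional MGF of the aggregate interference, with $w=z\overline{\varphi}P$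 and $$\mathcal A=\Gamma\!\left(1-\tfrac2\alpha\right)\Gamma\!\left(1+\tfrac2\alpha\right)w^{2/\alpha}-\frac{R^2}{1+R^{\alpha}/w}-\frac{R^{\alpha+2}}{w\,(1+\frac2\alpha)}\;{}_2F_1\!\left(2,1+\tfrac2\alpha;2+\tfrac2\alpha;-\tfrac{R^\alpha}{w}\right).$$ Then this double integral converges absolutely, and $$\tilde{\mathcal R}=\log_2(e)\int_0^{\pi/2}\frac{\alpha^2(\alpha+2)\tan(t)\cos^{2\alpha}(t)}{2\bigl(\overline{\varphi}\sin^\alpha(t)+\cos^\alpha(t)\bigr)\Bigl(\alpha\sin^{\alpha+2}(t)\,{}_2F_1\!\left(1,1+\tfrac2\alpha;2+\tfrac2\alpha;-\tan^\alpha(t)\right)+\pi(\alpha+2)\csc\!\left(\tfrac{2\pi}{\alpha}\right)\cos^{\alpha+2}(t)\Bigr)}\,dt,$$ where $\csc\left(\frac{2\pi}{\alpha}\right)=\frac{\alpha}{2\pi}\Gamma\left(1-\frac2\alpha\right)\Gamma\left(1+\frac2\alpha\right)$. If moreover $\alpha=4$, then $$\tilde{\mathcal R}=\log_2(e)\int_0^{\infty}\frac{4}{(1+\overline{\varphi}s^2)(2s-2\arctan(s)+\pi)}\,ds=\log_2(e)\int_0^{\infty}\frac{4}{2(1+\overline{\varphi}s^2)\bigl(s+\arctan(\frac1s)\bigr)}\,ds.$$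 All these single integrals converge absolutely. -/

import Mathlib

open MeasureTheory

/-- The Gauss hypergeometric function `₂F₁(a, b; c; z)` for real parameters `0 < b < c` and real
arguments `z < 1`, given by the Euler integral. It agrees with the Gauss series for `|z| < 1`
(see `gaussHypergeometric_eq_series`) and is its analytic continuation for `z ≤ -1`, where the
series diverges and Mathlib's `ordinaryHypergeometric` takes a junk value. -/
noncomputable def gaussHypergeometric (a b c z : ℝ) : ℝ :=
  Real.Gamma c / (Real.Gamma b * Real.Gamma (c - b)) *
    ∫ x in (0 : ℝ)..1, x ^ (b - 1) * (1 - x) ^ (c - b - 1) * (1 - z * x) ^ (-a)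

/-- The Beta integral over the reals. -/
theorem beta_kernel {u v : ℝ} (hu : 0 < u) (hv : 0 < v) :
    IntervalIntegrable (fun x : ℝ => x ^ (u - 1) * (1 - x) ^ (v - 1)) volume 0 1 ∧
    ∫ x in (0 : ℝ)..1, x ^ (u - 1) * (1 - x) ^ (v - 1) =
      Real.Gamma u * Real.Gamma v / Real.Gamma (u + v) := by
  have key : Set.EqOn (fun x : ℝ => ((x : ℂ) ^ ((u : ℂ) - 1) * (1 - (x : ℂ)) ^ ((v : ℂ) - 1)))
      (fun x : ℝ => ((x ^ (u - 1) * (1 - x) ^ (v - 1) : ℝ) : ℂ)) (Set.Icc 0 1) := by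
    intro x hx
    simp only
    rw [Complex.ofReal_mul, Complex.ofReal_cpow hx.1, Complex.ofReal_cpow (sub_nonneg.2 hx.2)]
    push_cast
    rfl
  constructor
  · have h := Complex.betaIntegral_convergent (u := u) (v := v) (by simpa) (by simpa)
    rw [intervalIntegrable_iff_integrableOn_Ioc_of_le zero_le_one] at h ⊢
    have h2 : IntegrableOn (fun x : ℝ => ((x ^ (u - 1) * (1 - x) ^ (v - 1) : ℝ) : ℂ))
        (Set.Ioc 0 1) volume :=
      h.congr_fun (fun x hx => key ⟨hx.1.le, hx.2⟩) measurableSet_Ioc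
    have h3 := Integrable.re h2
    simpa using! h3
  · have h := Complex.betaIntegral_eq_Gamma_mul_div (u : ℂ) (v : ℂ) (by simpa) (by simpa)
    rw [Complex.betaIntegral, intervalIntegral.integral_congr (g := fun x : ℝ =>
      ((x ^ (u - 1) * (1 - x) ^ (v - 1) : ℝ) : ℂ)) (by simpa using key),
      intervalIntegral.integral_ofReal, ← Complex.ofReal_add, Complex.Gamma_ofReal,
      Complex.Gamma_ofReal, Complex.Gamma_ofReal] at h
    exact_mod_cast h

theorem gamma_pochhammer {b : ℝ} (hb : 0 < b) (n : ℕ) :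
    Real.Gamma (b + n) = (ascPochhammer ℝ n).eval b * Real.Gamma b := by
  induction n with
  | zero => simp
  | succ n ih =>
    rw [Nat.cast_succ, ← add_assoc, Real.Gamma_add_one (by positivity), ih,
      ascPochhammer_succ_eval]
    ring

theorem choose_pochhammer (a : ℝ) (n : ℕ) :
    Ring.choose (a + n - 1) n = (n.factorial : ℝ)⁻¹ * (ascPochhammer ℝ n).eval a := by
  rw [Ring.choose_eq_smul, Polynomial.descPochhammer_smeval_eq_ascPochhammer,
    Polynomial.ascPochhammer_smeval_eq_eval]
  rw [show a + (n : ℝ) - 1 - n + 1 = a by ring]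
  simp

/-- Inside the unit disc, the Euler integral is the Gauss series `∑ (a)ₙ (b)ₙ / ((c)ₙ n!) zⁿ`. -/
theorem gaussHypergeometric_eq_series (a : ℝ) {b c z : ℝ} (hb : 0 < b) (hbc : b < c)
    (hz : |z| < 1) :
    gaussHypergeometric a b c z = ordinaryHypergeometric a b c z := by
  have hv : 0 < c - b := sub_pos.2 hbc
  have hc : 0 < c := hb.trans hbc
  set k : ℕ → ℝ := fun n => (n.factorial : ℝ)⁻¹ * (ascPochhammer ℝ n).eval a with hk
  have hG : ∀ w : ℝ, |w| < 1 → Summable (fun n => |k n| * |w| ^ n) ∧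
      HasSum (fun n => k n * w ^ n) ((1 - w) ^ (-a)) := by
    intro w hw
    have H := Real.one_div_one_sub_rpow_hasFPowerSeriesOnBall_zero a
    have hw' : w ∈ Metric.eball (0 : ℝ) 1 := by
      simpa [Metric.mem_eball, edist_dist, Real.dist_eq] using hw
    have h1 := H.hasSum hw'
    have h2 := FormalMultilinearSeries.summable_norm_apply (x := w)
      (FormalMultilinearSeries.ofScalars ℝ fun n ↦ Ring.choose (a + n - 1) n)
      (Metric.eball_subset_eball H.r_le hw')
    simp only [FormalMultilinearSeries.ofScalars_apply_eq, choose_pochhammer, smul_eq_mul, zero_add,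
      norm_mul, norm_pow, Real.norm_eq_abs] at h1 h2
    refine ⟨by simpa [hk, abs_mul] using h2, ?_⟩
    have hw0 : 0 ≤ 1 - w := by linarith [(abs_lt.1 hw).2]
    rw [Real.rpow_neg hw0, ← one_div]
    exact h1
  have hbeta : ∀ n : ℕ, IntervalIntegrable
      (fun x : ℝ => x ^ (b + n - 1) * (1 - x) ^ (c - b - 1)) volume 0 1 ∧
      ∫ x in (0 : ℝ)..1, x ^ (b + n - 1) * (1 - x) ^ (c - b - 1) =
        Real.Gamma (b + n) * Real.Gamma (c - b) / Real.Gamma (c + n) := by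
    intro n
    have h := beta_kernel (u := b + n) (v := c - b) (by positivity) hv
    rwa [show b + n + (c - b) = c + n by ring] at h
  have hmul : ∀ (n : ℕ) (x : ℝ), x ∈ Set.Ioc (0 : ℝ) 1 →
      x ^ (b - 1) * (1 - x) ^ (c - b - 1) * (k n * (z * x) ^ n) =
        k n * z ^ n * (x ^ (b + n - 1) * (1 - x) ^ (c - b - 1)) := by
    intro n x hx
    rw [show b + n - 1 = (b - 1) + n by ring, Real.rpow_add hx.1, Real.rpow_natCast]
    ring
  have hs : HasSum (fun n : ℕ => ∫ x in Set.Ioc (0 : ℝ) 1,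
        k n * z ^ n * (x ^ (b + n - 1) * (1 - x) ^ (c - b - 1)))
      (∫ x in Set.Ioc (0 : ℝ) 1, x ^ (b - 1) * (1 - x) ^ (c - b - 1) * (1 - z * x) ^ (-a)) := by
    have hint : ∀ n : ℕ, Integrable (fun x : ℝ =>
        k n * z ^ n * (x ^ (b + n - 1) * (1 - x) ^ (c - b - 1)))
        (volume.restrict (Set.Ioc (0 : ℝ) 1)) := fun n => by
      have := (hbeta n).1
      rw [intervalIntegrable_iff_integrableOn_Ioc_of_le zero_le_one] at this
      exact this.const_mul _
    have hnn : ∀ (n : ℕ) (x : ℝ), x ∈ Set.Ioc (0 : ℝ) 1 →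
        0 ≤ x ^ (b + n - 1) * (1 - x) ^ (c - b - 1) := fun n x hx =>
      mul_nonneg (Real.rpow_nonneg hx.1.le _) (Real.rpow_nonneg (sub_nonneg.2 hx.2) _)
    have hsum : Summable fun n : ℕ => ∫ x in Set.Ioc (0 : ℝ) 1,
        ‖k n * z ^ n * (x ^ (b + n - 1) * (1 - x) ^ (c - b - 1))‖ := by
      refine Summable.of_nonneg_of_le (fun n => integral_nonneg fun x => norm_nonneg _) ?_
        ((hG z hz).1.mul_right (∫ x in Set.Ioc (0 : ℝ) 1,
          x ^ (b + (0 : ℕ) - 1) * (1 - x) ^ (c - b - 1)))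
      intro n
      rw [← integral_const_mul]
      refine setIntegral_mono_on (hint n).norm ?_ measurableSet_Ioc ?_
      · have := (hbeta 0).1
        rw [intervalIntegrable_iff_integrableOn_Ioc_of_le zero_le_one] at this
        exact this.const_mul _
      · intro x hx
        rw [norm_mul, Real.norm_of_nonneg (hnn n x hx), norm_mul, norm_pow, Real.norm_eq_abs,
          Real.norm_eq_abs]
        refine mul_le_mul_of_nonneg_left ?_ (by positivity)
        refine mul_le_mul_of_nonneg_right ?_ (Real.rpow_nonneg (sub_nonneg.2 hx.2) _)
        exact Real.rpow_le_rpow_of_exponent_ge hx.1 hx.2 (by simp)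
    have h := hasSum_integral_of_summable_integral_norm hint hsum
    rw [setIntegral_congr_fun (g := fun x : ℝ =>
      ∑' i : ℕ, k i * z ^ i * (x ^ (b + i - 1) * (1 - x) ^ (c - b - 1))) measurableSet_Ioc ?_]
    · exact h
    intro x hx
    have hzx : |z * x| < 1 := by
      rw [abs_mul, abs_of_pos hx.1]
      nlinarith [abs_nonneg z, hx.1, hx.2]
    have h2 := ((hG _ hzx).2.mul_left (x ^ (b - 1) * (1 - x) ^ (c - b - 1)))
    simp only [hmul _ x hx] at h2
    exact h2.tsum_eq.symm
  have hs2 := hs.mul_left (Real.Gamma c / (Real.Gamma b * Real.Gamma (c - b)))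
  rw [gaussHypergeometric, intervalIntegral.integral_of_le zero_le_one, ← hs2.tsum_eq,
    ordinaryHypergeometric_eq_tsum]
  refine tsum_congr fun n => ?_
  rw [integral_const_mul, ← intervalIntegral.integral_of_le zero_le_one, (hbeta n).2,
    gamma_pochhammer hb, gamma_pochhammer hc, smul_eq_mul]
  have h1 := (Real.Gamma_pos_of_pos hb).ne'
  have h2 := (Real.Gamma_pos_of_pos hc).ne'
  have h3 := (Real.Gamma_pos_of_pos hv).ne'
  have h4 := (ascPochhammer_pos n c hc).ne'
  simp only [hk]
  field_simp

/-- System parameters of a load-proportional cellular network with `T` tiers of base stations. -/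
structure DenseNet (T : ℕ) where
  /-- spatial density of the users -/
  userDensity : ℝ
  /-- spatial density of the base stations of each tier -/
  bsDensity : Fin T → ℝ
  /-- transmit power of each tier -/
  txPower : Fin T → ℝ
  /-- association biasing weight of each tier -/
  bias : Fin T → ℝ
  /-- path-loss exponent of each tier -/
  pathLoss : Fin T → ℝ
  /-- Nakagami-m fading parameter of each tier (`1` is Rayleigh fading) -/
  fading : Fin T → ℝ
  /-- law of the shadowing power gain of each tier -/
  shadowing : Fin T → Measure ℝ
  /-- additive noise power (`0` in the interference-limited regime) -/
  noise : ℝ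
  userDensity_pos : 0 < userDensity
  bsDensity_pos : ∀ t, 0 < bsDensity t
  txPower_pos : ∀ t, 0 < txPower t
  bias_pos : ∀ t, 0 < bias t
  two_lt_pathLoss : ∀ t, 2 < pathLoss t
  fading_pos : ∀ t, 0 < fading t
  shadowing_prob : ∀ t, IsProbabilityMeasure (shadowing t)
  shadowing_pos : ∀ t, ∀ᵐ x ∂(shadowing t), 0 < x
  shadowing_moment : ∀ t, Integrable (fun x : ℝ => x ^ (2 / pathLoss t)) (shadowing t)
  noise_nonneg : 0 ≤ noise

namespace DenseNet

/-- `E[χ_t ^ (2 / α_t)]`, the fractional moment of the shadowing gain. -/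
noncomputable def shadowMoment {T : ℕ} (N : DenseNet T) (t : Fin T) : ℝ :=
  ∫ x, x ^ (2 / N.pathLoss t) ∂(N.shadowing t)

/-- `∑ t, λ_t E[χ_t^(2/α_t)] (β_t P_t / (β_s P_s))^(2/α_t) r^(2 α_s / α_t)`: the mean number, up to
the factor `π`, of base stations of all tiers which are preferred to a base station of the serving
tier `s` at distance `r`. -/
noncomputable def exclusion {T : ℕ} (N : DenseNet T) (s : Fin T) (r : ℝ) : ℝ :=
  ∑ t, N.bsDensity t * N.shadowMoment t *
    (N.bias t * N.txPower t / (N.bias s * N.txPower s)) ^ (2 / N.pathLoss t) *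
    r ^ (2 * N.pathLoss s / N.pathLoss t)

/-- The probability that a user connects to tier `s`. -/
noncomputable def connectionProb {T : ℕ} (N : DenseNet T) (s : Fin T) : ℝ :=
  2 * Real.pi * N.bsDensity s * N.shadowMoment s *
    ∫ r in Set.Ioi (0 : ℝ), r * Real.exp (-(Real.pi * N.exclusion s r))

/-- The density of the distance between a user of tier `s` and its serving base station. -/
noncomputable def distancePDF {T : ℕ} (N : DenseNet T) (s : Fin T) (R : ℝ) : ℝ :=
  2 * Real.pi * R * N.bsDensity s / N.connectionProb s * N.shadowMoment s *
    Real.exp (-(Real.pi * N.exclusion s R))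

/-- The load of tier `t`, i.e. the activity probability of its base stations. -/
noncomputable def load {T : ℕ} (N : DenseNet T) (t : Fin T) : ℝ :=
  1 - Real.exp (-(N.userDensity * N.connectionProb t) / (N.bsDensity t * N.shadowMoment t))

/-- The conditional MGF `E_H[exp (-z P_s H R^(-α_s))]` of the intended signal power, where the
fading gain `H` has the unit-mean Gamma law with shape and rate `m_s`. -/
noncomputable def signalMGF {T : ℕ} (N : DenseNet T) (s : Fin T) (R z : ℝ) : ℝ :=
  ∫ h, Real.exp (-(z * N.txPower s * h * R ^ (-N.pathLoss s)))
    ∂(ProbabilityTheory.gammaMeasure (N.fading s) (N.fading s))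

/-- The contribution `A_t` of tier `t` to the exponent of the interference MGF bound, for a user
at distance `R` from its serving base station of tier `s`. Here `w = z φ_t P_t` and
`d = β_t P_t R^(α_s) / (β_s P_s)`. -/
noncomputable def interferenceExponent {T : ℕ} (N : DenseNet T) (s t : Fin T) (R z : ℝ) : ℝ :=
  let m := N.fading t
  let δ := 2 / N.pathLoss t
  let w := z * N.load t * N.txPower t
  let d := N.bias t * N.txPower t * R ^ N.pathLoss s / (N.bias s * N.txPower s)
  Real.Gamma (1 - δ) * Real.Gamma (m + δ) / Real.Gamma m * (w / m) ^ δ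
    + d ^ δ * (m ^ m * (w / d + m) ^ (-m) - 1)
    - m ^ (m + 1) / (w ^ m * (m + δ)) * d ^ (m + δ) *
        gaussHypergeometric (m + 1) (m + δ) (m + δ + 1) (-(m * d) / w)

/-- The closed-form bound of the conditional MGF of the aggregate interference in
spatially-correlated load-proportional networks. -/
noncomputable def interferenceMGF {T : ℕ} (N : DenseNet T) (s : Fin T) (R z : ℝ) : ℝ :=
  Real.exp (-(Real.pi *
    ∑ t, N.bsDensity t * N.shadowMoment t * N.interferenceExponent s t R z))

/-- The integrand of the average rate (in nat/s/Hz) of a user served by tier `s`. -/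
noncomputable def rateIntegrand {T : ℕ} (N : DenseNet T) (s : Fin T) (R z : ℝ) : ℝ :=
  N.interferenceMGF s R z * (1 - N.signalMGF s R z) * (Real.exp (-(z * N.noise)) / z) *
    N.distancePDF s R

/-- The average rate bound, in b/s/Hz. -/
noncomputable def avgRateBound {T : ℕ} (N : DenseNet T) : ℝ :=
  Real.logb 2 (Real.exp 1) * ∑ s, N.connectionProb s *
    ∫ R in Set.Ioi (0 : ℝ), ∫ z in Set.Ioi (0 : ℝ), N.rateIntegrand s R z

end DenseNet

/-! The argument is a scaling reduction followed by Tonelli. Put `δ = 2 / α` and `y = w / R ^ α`,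
with `w = z φ P`. Then `1 + A / R ^ 2` depends on `y` alone: it is `b(y) = rateShape δ y`
(`rateShape_eq`, by an integration by parts in the Euler integral). Rayleigh fading gives `1 - M = y
/ (φ + y)`, and `dz / z = dy / y` for fixed `R`. The factor `exp (-π λ R ^ 2)` of the distance
density supplies the missing `1`, so the double integral becomes that of `2 π λ R / (φ + y) * exp
(-π λ R ^ 2 b(y))` (`DenseNet.rateIntegrand_eq`, `integrable_prod_rescale`).

This integrand is positive and elementary in `R`. Integrating over `R` first leaves `1 / ((φ + y)
b(y))` (`integrable_rayleigh_kernel`), in which neither `λ` nor `P` appears except through `φ`. The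
bound `b(y) ≥ C y ^ δ` with `0 < δ < 1` makes this kernel integrable at both ends, which yields
every claim of absolute convergence. The stated formulas are the substitutions `y = tan t ^ (-α)`
and, for `α = 4`, `y = s ^ (-2)`. -/

/-! ### The shape function and its closed forms. -/

/-- `1 + A / R ^ 2` as a function of the scaled variable `y = w / R ^ α`, where `δ = 2 / α`. -/
noncomputable def rateShape (δ y : ℝ) : ℝ :=
  Real.pi * δ / Real.sin (Real.pi * δ) * y ^ δ + δ * ∫ x in (0 : ℝ)..1, x ^ δ / (x + y)

theorem sin_pi_mul_pos {δ : ℝ} (h0 : 0 < δ) (h1 : δ < 1) : 0 < Real.sin (Real.pi * δ) :=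
  Real.sin_pos_of_pos_of_lt_pi (mul_pos Real.pi_pos h0) (by nlinarith [Real.pi_pos])

theorem gamma_one_sub_mul_gamma_one_add {δ : ℝ} (h0 : δ ≠ 0) :
    Real.Gamma (1 - δ) * Real.Gamma (1 + δ) = Real.pi * δ / Real.sin (Real.pi * δ) := by
  rw [add_comm, Real.Gamma_add_one h0, mul_div_right_comm, ← Real.Gamma_mul_Gamma_one_sub]
  ring

/-- For `c = b + 1` the exponent of `1 - x` vanishes and the Gamma quotient collapses to `b`. -/
theorem gaussHypergeometric_add_one (a z : ℝ) {b : ℝ} (hb : 0 < b) :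
    gaussHypergeometric a b (b + 1) z =
      b * ∫ x in (0 : ℝ)..1, x ^ (b - 1) * (1 - z * x) ^ (-a) := by
  have := (Real.Gamma_pos_of_pos hb).ne'
  rw [gaussHypergeometric, Real.Gamma_add_one hb.ne']
  simp
  left
  field_simp

theorem continuousOn_rpow_div_add {δ y : ℝ} (h0 : 0 < δ) (hy : 0 < y) :
    ContinuousOn (fun x : ℝ => x ^ δ / (x + y)) (Set.Icc 0 1) :=
  (Real.continuous_rpow_const h0.le).continuousOn.div (by fun_prop)
    fun x hx => by have := hx.1; positivity

/-- Dropping the nonnegative integral leaves a pure power of `y`, the only lower bound that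
convergence needs. -/
theorem le_rateShape {δ y : ℝ} (h0 : 0 < δ) (hy : 0 < y) :
    Real.pi * δ / Real.sin (Real.pi * δ) * y ^ δ ≤ rateShape δ y := by
  refine le_add_of_nonneg_right (mul_nonneg h0.le
    (intervalIntegral.integral_nonneg zero_le_one fun x hx => ?_))
  have := hx.1
  positivity

theorem rateShape_pos {δ y : ℝ} (h0 : 0 < δ) (h1 : δ < 1) (hy : 0 < y) : 0 < rateShape δ y := by
  have := sin_pi_mul_pos h0 h1
  have := Real.pi_pos
  exact lt_of_lt_of_le (by positivity) (le_rateShape h0 hy)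

theorem measurable_rateShape (δ : ℝ) : Measurable (rateShape δ) := by
  unfold rateShape
  simp_rw [intervalIntegral.integral_of_le zero_le_one]
  have h : StronglyMeasurable fun y : ℝ => ∫ x in Set.Ioc (0 : ℝ) 1, x ^ δ / (x + y) := by
    refine StronglyMeasurable.integral_prod_right (f := fun y x : ℝ => x ^ δ / (x + y)) ?_
    exact Measurable.stronglyMeasurable (by simp only [Function.uncurry_def]; fun_prop)
  exact ((measurable_id.pow_const δ).const_mul _).add (h.measurable.const_mul _)

/-- The closed form of the interference exponent, divided by `R ^ 2` and increased by one. -/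
theorem rateShape_eq {δ y : ℝ} (h0 : 0 < δ) (hy : 0 < y) :
    1 + (Real.pi * δ / Real.sin (Real.pi * δ) * y ^ δ + ((y + 1) ^ (-1 : ℝ) - 1) -
      1 / (y * (1 + δ)) * gaussHypergeometric 2 (1 + δ) (1 + δ + 1) (-1 / y)) = rateShape δ y := by
  rw [gaussHypergeometric_add_one _ _ (by positivity), Real.rpow_neg_one]
  have hne : ∀ x ∈ Set.Icc (0 : ℝ) 1, x + y ≠ 0 := fun x hx => by
    have := hx.1
    positivity
  have e : (∫ x in (0 : ℝ)..1, x ^ (1 + δ - 1) * (1 - -1 / y * x) ^ (-2 : ℝ)) =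
      ∫ x in (0 : ℝ)..1, y ^ 2 * (x ^ δ / (x + y) ^ 2) := by
    refine intervalIntegral.integral_congr fun x hx => ?_
    rw [Set.uIcc_of_le zero_le_one] at hx
    have h1 := hne x hx
    have h2 : 1 - -1 / y * x = (x + y) / y := by field_simp; ring
    have h3 : 0 ≤ (x + y) / y := by have := hx.1; positivity
    rw [h2, Real.rpow_neg h3, Real.rpow_two, add_sub_cancel_left]
    field_simp
  have hc2 : ContinuousOn (fun x : ℝ => x ^ δ / (x + y) ^ 2) (Set.Icc 0 1) :=
    (Real.continuous_rpow_const h0.le).continuousOn.div (by fun_prop)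
      fun x hx => pow_ne_zero 2 (hne x hx)
  have hc1 := continuousOn_rpow_div_add h0 hy
  have i1 : IntervalIntegrable (fun x : ℝ => δ * (x ^ δ / (x + y))) volume 0 1 :=
    (hc1.const_mul δ).intervalIntegrable_of_Icc zero_le_one
  have i2 : IntervalIntegrable (fun x : ℝ => y * (x ^ δ / (x + y) ^ 2)) volume 0 1 :=
    (hc2.const_mul y).intervalIntegrable_of_Icc zero_le_one
  -- Integration by parts: differentiating `x ^ (δ + 1) / (x + y)` trades the kernel `(x + y) ^
  -- (-2)` for `(x + y) ^ (-1)`. The boundary term `1 / (1 + y)` cancels the one in the exponent.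
  have ftc := intervalIntegral.integral_eq_sub_of_hasDerivAt_of_le (a := 0) (b := 1)
    (f := fun x : ℝ => x ^ (δ + 1) / (x + y))
    (f' := fun x : ℝ => δ * (x ^ δ / (x + y)) + y * (x ^ δ / (x + y) ^ 2)) zero_le_one
    ((Real.continuous_rpow_const (by positivity)).continuousOn.div (by fun_prop) hne)
    (fun x hx => by
      have h1 := hne x ⟨hx.1.le, hx.2.le⟩
      have hd := (Real.hasDerivAt_rpow_const (p := δ + 1) (Or.inl hx.1.ne')).div
        ((hasDerivAt_id x).add_const y) h1
      refine hd.congr_deriv ?_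
      rw [add_sub_cancel_right, Real.rpow_add_one hx.1.ne', id]
      field_simp
      ring)
    (i1.add i2)
  rw [intervalIntegral.integral_add i1 i2, intervalIntegral.integral_const_mul,
    intervalIntegral.integral_const_mul] at ftc
  simp only [Real.one_rpow, Real.zero_rpow (by positivity : δ + 1 ≠ 0), zero_div, sub_zero] at ftc
  rw [e, intervalIntegral.integral_const_mul, rateShape]
  have : y * (∫ x in (0 : ℝ)..1, x ^ δ / (x + y) ^ 2) =
    1 / (1 + y) - δ * ∫ x in (0 : ℝ)..1, x ^ δ / (x + y) := by linarith
  have h3 : 1 / (y * (1 + δ)) * ((1 + δ) * (y ^ 2 * ∫ x in (0 : ℝ)..1, x ^ δ / (x + y) ^ 2)) =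
      y * (∫ x in (0 : ℝ)..1, x ^ δ / (x + y) ^ 2) := by
    field_simp
  rw [h3, this, add_comm y 1, one_div]
  ring

/-- The value of `rateShape` in terms of the hypergeometric function of the final formula. -/
theorem rateShape_eq_gaussHypergeometric {δ y : ℝ} (h0 : 0 < δ) (hy : 0 < y) :
    rateShape δ y = Real.pi * δ / Real.sin (Real.pi * δ) * y ^ δ +
      δ / ((1 + δ) * y) * gaussHypergeometric 1 (1 + δ) (2 + δ) (-y⁻¹) := by
  rw [show 2 + δ = 1 + δ + 1 by ring, gaussHypergeometric_add_one _ _ (by positivity), rateShape]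
  have e : (∫ x in (0 : ℝ)..1, x ^ (1 + δ - 1) * (1 - -y⁻¹ * x) ^ (-1 : ℝ)) =
      ∫ x in (0 : ℝ)..1, y * (x ^ δ / (x + y)) := by
    refine intervalIntegral.integral_congr fun x hx => ?_
    rw [Set.uIcc_of_le zero_le_one] at hx
    have h1 : x + y ≠ 0 := by have := hx.1; positivity
    have h2 : 1 - -y⁻¹ * x = (x + y) / y := by field_simp; ring
    rw [h2, Real.rpow_neg_one, add_sub_cancel_left]
    field_simp
  rw [e, intervalIntegral.integral_const_mul]
  field_simp

theorem rateShape_half {s : ℝ} (hs : 0 < s) :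
    rateShape (1 / 2) (s ^ (-2 : ℝ)) = (2 * s - 2 * Real.arctan s + Real.pi) / (2 * s) := by
  have hp : s ^ (-2 : ℝ) = (s ^ 2)⁻¹ := by rw [Real.rpow_neg hs.le, Real.rpow_two]
  have hy : 0 < (s ^ 2)⁻¹ := by positivity
  rw [hp, rateShape, mul_one_div, Real.sin_pi_div_two, ← Real.sqrt_eq_rpow,
    Real.sqrt_inv, Real.sqrt_sq hs.le]
  have i1 : IntervalIntegrable (fun x : ℝ => (1 / 2) * (x ^ (1 / 2 : ℝ) / (x + (s ^ 2)⁻¹)))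
      volume 0 1 :=
    ((continuousOn_rpow_div_add (by norm_num) hy).const_mul _).intervalIntegrable_of_Icc
      zero_le_one
  -- The primitive comes from `x = q ^ 2`, which turns the integrand into `1 - 1 / (1 + s ^ 2 q ^
  -- 2)`. Differentiability is used only inside the interval, as `√x` has no derivative at `0`.
  have ftc := intervalIntegral.integral_eq_sub_of_hasDerivAt_of_le (a := 0) (b := 1)
    (f := fun x : ℝ => √x - s⁻¹ * Real.arctan (s * √x))
    (f' := fun x : ℝ => (1 / 2) * (x ^ (1 / 2 : ℝ) / (x + (s ^ 2)⁻¹))) zero_le_one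
    (by fun_prop)
    (fun x hx => by
      have hd := Real.hasDerivAt_sqrt hx.1.ne'
      refine (hd.sub (((hd.const_mul s).arctan).const_mul s⁻¹)).congr_deriv ?_
      have h1 : 0 < √x := Real.sqrt_pos.2 hx.1
      rw [← Real.sqrt_eq_rpow]
      have h2 : x = √x ^ 2 := (Real.sq_sqrt hx.1.le).symm
      generalize √x = q at h1 h2
      subst h2
      field_simp
      ring)
    i1
  rw [intervalIntegral.integral_const_mul] at ftc
  rw [ftc]
  simp
  field_simp
  ring

/-! ### Convergence, averaging over the distance, and rescaling. -/

theorem integral_Ioi_mul_exp_neg_mul_sq {k : ℝ} (hk : 0 < k) :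
    ∫ x in Set.Ioi (0 : ℝ), x * Real.exp (-(k * x ^ 2)) = (2 * k)⁻¹ := by
  have h := integral_rpow_mul_exp_neg_mul_rpow (p := 2) (q := 1) two_pos (by norm_num) hk
  norm_num [Real.rpow_neg_one] at h
  rw [mul_inv, mul_comm, ← one_div (2 : ℝ)]
  simpa using h

theorem integrableOn_rateShape_kernel {δ φ : ℝ} (h0 : 0 < δ) (h1 : δ < 1) (hφ : 0 < φ) :
    IntegrableOn (fun y => 1 / ((φ + y) * rateShape δ y)) (Set.Ioi 0) := by
  set C := Real.pi * δ / Real.sin (Real.pi * δ) with hC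
  have hCpos : 0 < C := by
    have := sin_pi_mul_pos h0 h1
    have := Real.pi_pos
    positivity
  have hm := measurable_rateShape δ
  have hmeas : Measurable (fun y => 1 / ((φ + y) * rateShape δ y)) := by fun_prop
  rw [← Set.Ioc_union_Ioi_eq_Ioi zero_le_one]
  refine IntegrableOn.union ?_ ?_
  -- Near `0`, bound `φ + y` below by `φ`; the majorant `y ^ (-δ)` is integrable because `δ < 1`.
  · have hi : IntegrableOn (fun y : ℝ => (φ * C)⁻¹ * y ^ (-δ)) (Set.Ioc 0 1) := by
      have := intervalIntegral.intervalIntegrable_rpow' (a := 0) (b := 1) (r := -δ) (by linarith)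
      rw [intervalIntegrable_iff_integrableOn_Ioc_of_le zero_le_one] at this
      exact this.const_mul _
    refine hi.mono' hmeas.aestronglyMeasurable ?_
    refine (ae_restrict_iff' measurableSet_Ioc).2 (.of_forall fun y hy => ?_)
    have hy0 := hy.1
    have hb := le_rateShape h0 hy0
    have hb' := rateShape_pos h0 h1 hy0
    rw [Real.norm_of_nonneg (by positivity), Real.rpow_neg hy0.le, ← mul_inv, one_div]
    refine inv_anti₀ (by positivity) ?_
    rw [mul_assoc]
    exact mul_le_mul (by linarith) hb (by positivity) (by positivity)
  -- Near infinity, bound `φ + y` below by `y`; the majorant `y ^ (-(1 + δ))` is integrable because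
  -- `δ > 0`.
  · have hi : IntegrableOn (fun y : ℝ => C⁻¹ * y ^ (-(1 + δ))) (Set.Ioi 1) :=
      (integrableOn_Ioi_rpow_of_lt (by linarith) one_pos).const_mul _
    refine hi.mono' hmeas.aestronglyMeasurable ?_
    refine (ae_restrict_iff' measurableSet_Ioi).2 (.of_forall fun y hy => ?_)
    have hy0 : 0 < y := one_pos.trans hy
    have hb := le_rateShape h0 hy0
    have hb' := rateShape_pos h0 h1 hy0
    rw [Real.norm_of_nonneg (by positivity), Real.rpow_neg hy0.le, ← mul_inv, one_div]
    refine inv_anti₀ (by positivity) ?_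
    rw [Real.rpow_one_add' hy0.le (by positivity), mul_left_comm]
    exact mul_le_mul (by linarith) hb (by positivity) (by positivity)

/-- Averaging over the Rayleigh distributed serving distance, before rescaling. -/
theorem integrable_rayleigh_kernel {b : ℝ → ℝ} {φ μ : ℝ} (hb : Measurable b)
    (hpos : ∀ y, 0 < y → 0 < b y) (hφ : 0 < φ) (hμ : 0 < μ)
    (hint : IntegrableOn (fun y => 1 / ((φ + y) * b y)) (Set.Ioi 0)) :
    Integrable (fun p : ℝ × ℝ =>
        2 * Real.pi * μ * p.1 / (φ + p.2) * Real.exp (-(Real.pi * μ * p.1 ^ 2 * b p.2)))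
      ((volume.restrict (Set.Ioi 0)).prod (volume.restrict (Set.Ioi 0))) ∧
    ∫ R in Set.Ioi (0 : ℝ), ∫ y in Set.Ioi (0 : ℝ),
        2 * Real.pi * μ * R / (φ + y) * Real.exp (-(Real.pi * μ * R ^ 2 * b y)) =
      ∫ y in Set.Ioi (0 : ℝ), 1 / ((φ + y) * b y) := by
  have hπ := Real.pi_pos
  have e : ∀ R y : ℝ, 2 * Real.pi * μ * R / (φ + y) * Real.exp (-(Real.pi * μ * R ^ 2 * b y)) =
      2 * Real.pi * μ / (φ + y) * (R * Real.exp (-(Real.pi * μ * b y * R ^ 2))) := fun R y => by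
    rw [show Real.pi * μ * R ^ 2 * b y = Real.pi * μ * b y * R ^ 2 by ring]
    ring
  have hin : ∀ y ∈ Set.Ioi (0 : ℝ), ∫ R in Set.Ioi (0 : ℝ),
      2 * Real.pi * μ * R / (φ + y) * Real.exp (-(Real.pi * μ * R ^ 2 * b y)) =
        1 / ((φ + y) * b y) := fun y hy => by
    have hy0 : 0 < y := hy
    have := hpos y hy
    simp_rw [e]
    rw [integral_const_mul, integral_Ioi_mul_exp_neg_mul_sq (by positivity)]
    field_simp
  have hI : Integrable (fun p : ℝ × ℝ =>
        2 * Real.pi * μ * p.1 / (φ + p.2) * Real.exp (-(Real.pi * μ * p.1 ^ 2 * b p.2)))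
      ((volume.restrict (Set.Ioi 0)).prod (volume.restrict (Set.Ioi 0))) := by
    -- Tonelli with `R` innermost: each slice is Gaussian in `R`, and by positivity its norm
    -- integrates to the kernel assumed integrable.
    rw [integrable_prod_iff' (Measurable.aestronglyMeasurable (by fun_prop))]
    constructor
    · refine (ae_restrict_iff' measurableSet_Ioi).2 (.of_forall fun y hy => ?_)
      have := hpos y hy
      simp only [e]
      have h := (integrable_mul_exp_neg_mul_sq (b := Real.pi * μ * b y) (by positivity)).const_mul
        (2 * Real.pi * μ / (φ + y))
      simpa only [neg_mul] using h.restrict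
    · refine IntegrableOn.congr_fun hint (fun y hy => ?_) measurableSet_Ioi
      simp only
      rw [← hin y hy]
      refine setIntegral_congr_fun measurableSet_Ioi fun R hR => ?_
      have : 0 < R := hR
      have : 0 < y := hy
      exact (Real.norm_of_nonneg (by positivity)).symm
  refine ⟨hI, ?_⟩
  rw [integral_integral_swap hI]
  exact setIntegral_congr_fun measurableSet_Ioi hin

/-- Rescaling the inner variable by a factor depending on the outer one. -/
theorem integrable_prod_rescale {f : ℝ × ℝ → ℝ} {c : ℝ → ℝ} (hf : Measurable f)
    (hc : Measurable c) (hpos : ∀ x, 0 < x → 0 < c x)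
    (hI : Integrable f ((volume.restrict (Set.Ioi 0)).prod (volume.restrict (Set.Ioi 0)))) :
    Integrable (fun p : ℝ × ℝ => c p.1 * f (p.1, c p.1 * p.2))
      ((volume.restrict (Set.Ioi 0)).prod (volume.restrict (Set.Ioi 0))) ∧
    ∫ x in Set.Ioi (0 : ℝ), ∫ z in Set.Ioi (0 : ℝ), c x * f (x, c x * z) =
      ∫ x in Set.Ioi (0 : ℝ), ∫ y in Set.Ioi (0 : ℝ), f (x, y) := by
  have hs : ∀ (g : ℝ → ℝ) (x : ℝ), x ∈ Set.Ioi (0 : ℝ) →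
      ∫ z in Set.Ioi (0 : ℝ), c x * g (c x * z) = ∫ y in Set.Ioi (0 : ℝ), g y := fun g x hx => by
    rw [integral_const_mul, ← smul_eq_mul, integral_comp_mul_left_Ioi' g 0 (hpos x hx), mul_zero]
  refine ⟨?_, setIntegral_congr_fun measurableSet_Ioi fun x hx => hs (fun y => f (x, y)) x hx⟩
  -- The substitution is made in each fibre `x` separately, for `f` and for its norm, so no
  -- two-dimensional Jacobian is needed.
  rw [integrable_prod_iff hf.aestronglyMeasurable] at hI
  rw [integrable_prod_iff (Measurable.aestronglyMeasurable (by fun_prop))]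
  constructor
  · filter_upwards [hI.1, ae_restrict_mem measurableSet_Ioi] with x h1 hx
    have h2 := (integrableOn_Ioi_comp_mul_left_iff (fun y => f (x, y)) 0 (hpos x hx)).2
      (by rwa [mul_zero])
    exact h2.const_mul _
  · refine IntegrableOn.congr_fun hI.2 (fun x hx => ?_) measurableSet_Ioi
    simp only
    rw [← hs (fun y => ‖f (x, y)‖) x hx]
    simp only [norm_mul, Real.norm_of_nonneg (hpos x hx).le]

/-! ### The tangent substitution and the Laplace transform of Rayleigh fading. -/

theorem image_tan_Ioo_zero : Real.tan '' Set.Ioo 0 (Real.pi / 2) = Set.Ioi 0 := by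
  ext s
  constructor
  · rintro ⟨t, ht, rfl⟩
    exact Real.tan_pos_of_pos_of_lt_pi_div_two ht.1 ht.2
  · intro hs
    exact ⟨Real.arctan s, ⟨Real.arctan_pos.2 hs, Real.arctan_lt_pi_div_two s⟩, Real.tan_arctan s⟩

theorem integral_exp_neg_mul_gammaMeasure_one {a : ℝ} (ha : 0 ≤ a) :
    ∫ h, Real.exp (-(a * h)) ∂(ProbabilityTheory.gammaMeasure 1 1) = 1 / (1 + a) := by
  rw [ProbabilityTheory.gammaMeasure, integral_withDensity_eq_integral_toReal_smul
    (by unfold ProbabilityTheory.gammaPDF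
        exact (ProbabilityTheory.measurable_gammaPDFReal 1 1).ennreal_ofReal)
    (by simp [ProbabilityTheory.gammaPDF])]
  have e : (fun h : ℝ => (ProbabilityTheory.gammaPDF 1 1 h).toReal • Real.exp (-(a * h))) =
      (Set.Ici (0 : ℝ)).indicator fun h => Real.exp (-(1 + a) * h) := by
    funext h
    by_cases hh : 0 ≤ h
    · rw [Set.indicator_of_mem (by exact hh), ProbabilityTheory.gammaPDF_of_nonneg hh]
      simp only [Real.one_rpow, Real.Gamma_one, div_one, sub_self, Real.rpow_zero, one_mul,
        smul_eq_mul]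
      rw [ENNReal.toReal_ofReal (Real.exp_pos _).le, ← Real.exp_add]
      ring_nf
    · rw [Set.indicator_of_notMem (by exact hh), ProbabilityTheory.gammaPDF_of_neg (not_le.1 hh)]
      simp
  rw [e, integral_indicator measurableSet_Ici, integral_Ici_eq_integral_Ioi,
    integral_exp_mul_Ioi (by linarith), mul_zero, Real.exp_zero, neg_div_neg_eq]

/-- The two outer factors on the left are the Jacobians of `s = tan t` and `y = s ^ (-α)`. -/
theorem tan_integrand_eq {α φ t : ℝ} (hα : 2 < α) (hφ : 0 < φ) (ht : t ∈ Set.Ioo 0 (Real.pi / 2)) :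
    |1 / Real.cos t ^ 2| • ((|-α| * Real.tan t ^ (-α - 1)) •
      (1 / ((φ + Real.tan t ^ (-α)) * rateShape (2 / α) (Real.tan t ^ (-α))))) =
    α ^ 2 * (α + 2) * Real.tan t * Real.cos t ^ (2 * α) /
        (2 * (φ * Real.sin t ^ α + Real.cos t ^ α) *
          (α * Real.sin t ^ (α + 2) *
              gaussHypergeometric 1 (1 + 2 / α) (2 + 2 / α) (-(Real.tan t ^ α)) +
            Real.pi * (α + 2) * (Real.sin (2 * Real.pi / α))⁻¹ * Real.cos t ^ (α + 2))) := by
  have hα0 : 0 < α := by linarith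
  have hδ0 : 0 < 2 / α := by positivity
  have hδ1 : 2 / α < 1 := (div_lt_one hα0).2 hα
  have hs : 0 < Real.tan t := Real.tan_pos_of_pos_of_lt_pi_div_two ht.1 ht.2
  have hc : 0 < Real.cos t := Real.cos_pos_of_mem_Ioo ⟨by linarith [ht.1, Real.pi_pos], ht.2⟩
  have hS : Real.sin t = Real.tan t * Real.cos t := (Real.tan_mul_cos hc.ne').symm
  have hy : Real.tan t ^ (-α) = (Real.tan t ^ α)⁻¹ := Real.rpow_neg hs.le α
  have hX : 0 < Real.tan t ^ α := Real.rpow_pos_of_pos hs α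
  have hY : 0 < Real.cos t ^ α := Real.rpow_pos_of_pos hc α
  have hyδ : (Real.tan t ^ (-α)) ^ (2 / α) = (Real.tan t ^ 2)⁻¹ := by
    rw [← Real.rpow_mul hs.le, show -α * (2 / α) = -2 by field_simp, Real.rpow_neg hs.le,
      Real.rpow_two]
  have hb := rateShape_pos hδ0 hδ1 (Real.rpow_pos_of_pos hs (-α))
  have hbe := rateShape_eq_gaussHypergeometric hδ0 (Real.rpow_pos_of_pos hs (-α))
  rw [hyδ, hy, inv_inv] at hbe
  rw [hy] at hb
  have hsin : Real.pi * (2 / α) = 2 * Real.pi / α := by ring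
  have hsinpos := sin_pi_mul_pos hδ0 hδ1
  rw [hsin] at hbe hsinpos
  rw [hS, Real.mul_rpow hs.le hc.le, Real.mul_rpow hs.le hc.le, Real.rpow_add hs, Real.rpow_add hc,
    mul_comm 2 α, Real.rpow_mul hc.le, Real.rpow_two, Real.rpow_two, Real.rpow_two, abs_neg,
    abs_of_pos hα0, abs_of_pos (by positivity), Real.rpow_sub_one hs.ne', hy, smul_eq_mul,
    smul_eq_mul]
  generalize gaussHypergeometric 1 (1 + 2 / α) (2 + 2 / α) (-(Real.tan t ^ α)) = F at hbe ⊢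
  generalize Real.tan t ^ α = X at *
  generalize Real.cos t ^ α = Y at *
  generalize Real.tan t = s at *
  generalize Real.cos t = c at *
  generalize Real.sin (2 * Real.pi / α) = q at *
  -- `D` is the last bracket of the target denominator divided by `cos t ^ (α + 2)`.
  set D := Real.pi * (α + 2) * q⁻¹ + α * X * s ^ 2 * F with hD
  have hbD : rateShape (2 / α) X⁻¹ = 2 * D / (α * (α + 2) * s ^ 2) := by
    rw [hbe, hD]
    field_simp
  rw [hbD] at hb ⊢
  -- The sign of `F` was lost on generalizing; positivity of `D` is recovered from that of
  -- `rateShape`.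
  have hD0 : 0 < D := by
    by_contra h
    have : 2 * D / (α * (α + 2) * s ^ 2) ≤ 0 :=
      div_nonpos_of_nonpos_of_nonneg (by linarith) (by positivity)
    linarith
  have hden : α * (X * s ^ 2 * (Y * c ^ 2)) * F + Real.pi * (α + 2) * q⁻¹ * (Y * c ^ 2) =
      Y * c ^ 2 * D := by rw [hD]; ring
  rw [hden]
  clear_value D
  field_simp

/-! ### Specialization of the network model to one tier. -/

namespace DenseNet

variable (N : DenseNet 1)

/-- `λ_s = λ_b E[χ^(2/α)]`, the equivalent density of the serving base stations. -/
noncomputable def eqDensity : ℝ := N.bsDensity 0 * N.shadowMoment 0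

theorem shadowMoment_pos : 0 < N.shadowMoment 0 := by
  have := N.shadowing_prob 0
  have hp : ∀ᵐ x ∂(N.shadowing 0), 0 < x ^ (2 / N.pathLoss 0) :=
    (N.shadowing_pos 0).mono fun x hx => Real.rpow_pos_of_pos hx _
  refine (integral_pos_iff_support_of_nonneg_ae (hp.mono fun x hx => hx.le)
    (N.shadowing_moment 0)).2 ?_
  refine pos_iff_ne_zero.2 fun h => ?_
  obtain ⟨x, hx, hx0⟩ := (hp.and (measure_eq_zero_iff_ae_notMem.1 h)).exists
  exact hx0 hx.ne'

theorem eqDensity_pos : 0 < N.eqDensity := mul_pos (N.bsDensity_pos 0) N.shadowMoment_pos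

/-- With a single tier, the ratio of biased powers is `1` and the path-loss exponents cancel. -/
theorem exclusion_eq (r : ℝ) : N.exclusion 0 r = N.eqDensity * r ^ 2 := by
  have h1 := (N.bias_pos 0).ne'
  have h2 := (N.txPower_pos 0).ne'
  have h3 : N.pathLoss 0 ≠ 0 := (two_pos.trans (N.two_lt_pathLoss 0)).ne'
  rw [exclusion, Fin.sum_univ_one, div_self (mul_ne_zero h1 h2), Real.one_rpow,
    mul_div_cancel_right₀ _ h3, Real.rpow_two, eqDensity, mul_one]

theorem connectionProb_eq_one : N.connectionProb 0 = 1 := by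
  have hμ := N.eqDensity_pos
  have hπ := Real.pi_pos
  simp_rw [connectionProb, exclusion_eq, ← mul_assoc]
  rw [integral_Ioi_mul_exp_neg_mul_sq (by positivity), mul_assoc _ (N.bsDensity 0), ← eqDensity]
  field_simp

theorem distancePDF_eq (R : ℝ) : N.distancePDF 0 R =
    2 * Real.pi * N.eqDensity * R * Real.exp (-(Real.pi * N.eqDensity * R ^ 2)) := by
  rw [distancePDF, connectionProb_eq_one, exclusion_eq, eqDensity]
  ring_nf

theorem load_eq : N.load 0 = 1 - Real.exp (-N.userDensity / N.eqDensity) := by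
  rw [load, connectionProb_eq_one, mul_one, eqDensity]

theorem load_pos : 0 < N.load 0 := by
  rw [load_eq, sub_pos, Real.exp_lt_one_iff]
  exact div_neg_of_neg_of_pos (neg_neg_of_pos N.userDensity_pos) N.eqDensity_pos

theorem one_sub_signalMGF (hm : N.fading 0 = 1) {R z : ℝ} (hR : 0 < R) (hz : 0 < z) :
    1 - N.signalMGF 0 R z =
      z * N.txPower 0 * R ^ (-N.pathLoss 0) / (1 + z * N.txPower 0 * R ^ (-N.pathLoss 0)) := by
  have hP := N.txPower_pos 0
  have h := integral_exp_neg_mul_gammaMeasure_one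
    (a := z * N.txPower 0 * R ^ (-N.pathLoss 0)) (by positivity)
  have e : N.signalMGF 0 R z = 1 / (1 + z * N.txPower 0 * R ^ (-N.pathLoss 0)) := by
    rw [signalMGF, hm, ← h]
    congr 1
    funext x
    ring_nf
  rw [e]
  field_simp
  ring

/-- The exponent is homogeneous: `R ^ 2` factors out, and `z` enters only through the scaled
variable `y`. -/
theorem interferenceExponent_eq (hm : N.fading 0 = 1) {R z : ℝ} (hR : 0 < R) (hz : 0 < z) :
    N.interferenceExponent 0 0 R z = R ^ 2 * (rateShape (2 / N.pathLoss 0)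
      (N.load 0 * N.txPower 0 * R ^ (-N.pathLoss 0) * z) - 1) := by
  have hP := N.txPower_pos 0
  have hb := N.bias_pos 0
  have hφ := N.load_pos
  have hα : 0 < N.pathLoss 0 := two_pos.trans (N.two_lt_pathLoss 0)
  have hδ : 0 < 2 / N.pathLoss 0 := by positivity
  have hX : 0 < R ^ N.pathLoss 0 := Real.rpow_pos_of_pos hR _
  have hw : 0 < z * N.load 0 * N.txPower 0 := by positivity
  have hd : N.bias 0 * N.txPower 0 * R ^ N.pathLoss 0 / (N.bias 0 * N.txPower 0) =
      R ^ N.pathLoss 0 := mul_div_cancel_left₀ _ (by positivity)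
  have hy : N.load 0 * N.txPower 0 * R ^ (-N.pathLoss 0) * z =
      z * N.load 0 * N.txPower 0 / R ^ N.pathLoss 0 := by
    rw [Real.rpow_neg hR.le]
    ring
  have hXδ : (R ^ N.pathLoss 0) ^ (2 / N.pathLoss 0) = R ^ 2 := by
    rw [← Real.rpow_mul hR.le, mul_div_cancel₀ _ hα.ne', Real.rpow_two]
  have key := rateShape_eq hδ (div_pos hw hX)
  rw [hy, ← key, ← gamma_one_sub_mul_gamma_one_add hδ.ne', Real.div_rpow hw.le hX.le, hXδ,
    interferenceExponent]
  simp only [hm, hd, Real.one_rpow, Real.rpow_one, Real.Gamma_one,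
    div_one, one_mul, hXδ, Real.rpow_add hX]
  rw [show (1 : ℝ) + 1 = 2 by norm_num,
    show -1 / (z * N.load 0 * N.txPower 0 / R ^ N.pathLoss 0) =
      -R ^ N.pathLoss 0 / (z * N.load 0 * N.txPower 0) by field_simp]
  field_simp
  ring

/-- The leading factor is `dy / dz` for fixed `R`, written in the form required by
`integrable_prod_rescale`. -/
theorem rateIntegrand_eq (hη : N.noise = 0) (hm : N.fading 0 = 1) {R z : ℝ} (hR : 0 < R)
    (hz : 0 < z) :
    N.rateIntegrand 0 R z = N.load 0 * N.txPower 0 * R ^ (-N.pathLoss 0) *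
      (2 * Real.pi * N.eqDensity * R /
        (N.load 0 + N.load 0 * N.txPower 0 * R ^ (-N.pathLoss 0) * z) *
        Real.exp (-(Real.pi * N.eqDensity * R ^ 2 * rateShape (2 / N.pathLoss 0)
          (N.load 0 * N.txPower 0 * R ^ (-N.pathLoss 0) * z)))) := by
  have hP := N.txPower_pos 0
  have hφ := N.load_pos
  have hX : 0 < R ^ (-N.pathLoss 0) := Real.rpow_pos_of_pos hR _
  rw [rateIntegrand, hη, one_sub_signalMGF N hm hR hz, distancePDF_eq, interferenceMGF,
    Fin.sum_univ_one, interferenceExponent_eq N hm hR hz, ← eqDensity]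
  generalize rateShape (2 / N.pathLoss 0)
    (N.load 0 * N.txPower 0 * R ^ (-N.pathLoss 0) * z) = b
  -- The `-1` in the interference exponent is absorbed by the exponential of the distance density.
  rw [show -(Real.pi * N.eqDensity * R ^ 2 * b) =
    -(Real.pi * (N.eqDensity * (R ^ 2 * (b - 1)))) + -(Real.pi * N.eqDensity * R ^ 2) by ring,
    Real.exp_add, mul_zero, neg_zero, Real.exp_zero]
  field_simp

theorem avgRateBound_eq_kernel (hη : N.noise = 0) (hm : N.fading 0 = 1) :
    IntegrableOn (fun p : ℝ × ℝ => N.rateIntegrand 0 p.1 p.2)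
      (Set.Ioi (0 : ℝ) ×ˢ Set.Ioi (0 : ℝ)) ∧
    N.avgRateBound = Real.logb 2 (Real.exp 1) *
      ∫ y in Set.Ioi (0 : ℝ), 1 / ((N.load 0 + y) * rateShape (2 / N.pathLoss 0) y) := by
  have hα := N.two_lt_pathLoss 0
  have hα0 := two_pos.trans hα
  have hδ0 : 0 < 2 / N.pathLoss 0 := by positivity
  have hδ1 : 2 / N.pathLoss 0 < 1 := (div_lt_one hα0).2 hα
  have hP := N.txPower_pos 0
  have hφ := N.load_pos
  have hb := measurable_rateShape (2 / N.pathLoss 0)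
  obtain ⟨hi, he⟩ := integrable_rayleigh_kernel hb (fun y => rateShape_pos hδ0 hδ1) hφ
    N.eqDensity_pos (integrableOn_rateShape_kernel hδ0 hδ1 hφ)
  obtain ⟨hi2, he2⟩ := integrable_prod_rescale
    (c := fun R => N.load 0 * N.txPower 0 * R ^ (-N.pathLoss 0)) (by fun_prop) (by fun_prop)
    (fun x hx => by positivity) hi
  constructor
  · rw [Measure.prod_restrict] at hi2
    exact IntegrableOn.congr_fun hi2
      (fun p hp => (N.rateIntegrand_eq hη hm hp.1 hp.2).symm)
      (measurableSet_Ioi.prod measurableSet_Ioi)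
  · rw [avgRateBound, Fin.sum_univ_one, connectionProb_eq_one, one_mul, ← he, ← he2]
    congr 1
    exact setIntegral_congr_fun measurableSet_Ioi fun R hR =>
      setIntegral_congr_fun measurableSet_Ioi fun z hz => N.rateIntegrand_eq hη hm hR hz

end DenseNet

/-! ### The rate formulas. -/

theorem lemma2 (N : DenseNet 1) (hη : N.noise = 0) (hm : N.fading 0 = 1)
    (α φ : ℝ) (hα : α = N.pathLoss 0)
    (hφ : φ = 1 - Real.exp (-N.userDensity /
      (N.bsDensity 0 * ∫ x, x ^ (2 / α) ∂(N.shadowing 0)))) :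
    IntegrableOn (fun p : ℝ × ℝ => N.rateIntegrand 0 p.1 p.2)
      (Set.Ioi (0 : ℝ) ×ˢ Set.Ioi (0 : ℝ)) ∧
    IntegrableOn (fun t : ℝ =>
      α ^ 2 * (α + 2) * Real.tan t * Real.cos t ^ (2 * α) /
        (2 * (φ * Real.sin t ^ α + Real.cos t ^ α) *
          (α * Real.sin t ^ (α + 2) *
              gaussHypergeometric 1 (1 + 2 / α) (2 + 2 / α) (-(Real.tan t ^ α)) +
            Real.pi * (α + 2) * (Real.sin (2 * Real.pi / α))⁻¹ * Real.cos t ^ (α + 2))))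
      (Set.Ioo 0 (Real.pi / 2)) ∧
    N.avgRateBound = Real.logb 2 (Real.exp 1) * ∫ t in (0 : ℝ)..(Real.pi / 2),
      α ^ 2 * (α + 2) * Real.tan t * Real.cos t ^ (2 * α) /
        (2 * (φ * Real.sin t ^ α + Real.cos t ^ α) *
          (α * Real.sin t ^ (α + 2) *
              gaussHypergeometric 1 (1 + 2 / α) (2 + 2 / α) (-(Real.tan t ^ α)) +
            Real.pi * (α + 2) * (Real.sin (2 * Real.pi / α))⁻¹ * Real.cos t ^ (α + 2))) ∧
    (Real.sin (2 * Real.pi / α))⁻¹ =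
      α / (2 * Real.pi) * Real.Gamma (1 - 2 / α) * Real.Gamma (1 + 2 / α) ∧
    (α = 4 →
      IntegrableOn (fun s : ℝ =>
        4 / ((1 + φ * s ^ 2) * (2 * s - 2 * Real.arctan s + Real.pi))) (Set.Ioi 0) ∧
      N.avgRateBound = Real.logb 2 (Real.exp 1) * ∫ s in Set.Ioi (0 : ℝ),
        4 / ((1 + φ * s ^ 2) * (2 * s - 2 * Real.arctan s + Real.pi)) ∧
      IntegrableOn (fun s : ℝ =>
        4 / (2 * (1 + φ * s ^ 2) * (s + Real.arctan (1 / s)))) (Set.Ioi 0) ∧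
      N.avgRateBound = Real.logb 2 (Real.exp 1) * ∫ s in Set.Ioi (0 : ℝ),
        4 / (2 * (1 + φ * s ^ 2) * (s + Real.arctan (1 / s)))) := by
  have hload : φ = N.load 0 := by
    rw [hφ, N.load_eq, DenseNet.eqDensity, DenseNet.shadowMoment, hα]
  have hα2 : 2 < α := hα ▸ N.two_lt_pathLoss 0
  have hα0 : 0 < α := two_pos.trans hα2
  have hδ0 : 0 < 2 / α := by positivity
  have hδ1 : 2 / α < 1 := (div_lt_one hα0).2 hα2
  have hφ0 : 0 < φ := hload ▸ N.load_pos
  have hπ := Real.pi_pos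
  obtain ⟨hI, hE⟩ := N.avgRateBound_eq_kernel hη hm
  rw [← hload, ← hα] at hE
  have hK := integrableOn_rateShape_kernel hδ0 hδ1 hφ0
  have hderiv : ∀ t ∈ Set.Ioo 0 (Real.pi / 2),
      HasDerivWithinAt Real.tan (1 / Real.cos t ^ 2) (Set.Ioo 0 (Real.pi / 2)) t := fun t ht =>
    (Real.hasDerivAt_tan_of_mem_Ioo ⟨by linarith [ht.1], ht.2⟩).hasDerivWithinAt
  have hinj : Set.InjOn Real.tan (Set.Ioo 0 (Real.pi / 2)) :=
    Real.injOn_tan.mono (Set.Ioo_subset_Ioo_left (by linarith))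
  refine ⟨hI, ?_, ?_, ?_, fun h4 => ?_⟩
  · have h1 := (integrableOn_Ioi_comp_rpow_iff _ (neg_ne_zero.2 hα0.ne')).2 hK
    rw [← image_tan_Ioo_zero,
      integrableOn_image_iff_integrableOn_abs_deriv_smul measurableSet_Ioo hderiv hinj] at h1
    exact h1.congr_fun (fun t ht => tan_integrand_eq hα2 hφ0 ht) measurableSet_Ioo
  · rw [hE, ← integral_comp_rpow_Ioi _ (neg_ne_zero.2 hα0.ne'), ← image_tan_Ioo_zero,
      integral_image_eq_integral_abs_deriv_smul measurableSet_Ioo hderiv hinj,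
      intervalIntegral.integral_of_le (by positivity), integral_Ioc_eq_integral_Ioo]
    congr 1
    exact setIntegral_congr_fun measurableSet_Ioo fun t ht => tan_integrand_eq hα2 hφ0 ht
  · have := sin_pi_mul_pos hδ0 hδ1
    rw [mul_assoc, gamma_one_sub_mul_gamma_one_add hδ0.ne', show 2 * Real.pi / α =
      Real.pi * (2 / α) by ring]
    field_simp
  · have h2 : 2 / α = 1 / 2 := by rw [h4]; norm_num
    rw [h2] at hK hE
    -- Here `y = s ^ (-2)` rather than `s ^ (-α)`, so that `y ^ δ = 1 / s`; this `s` corresponds to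
    -- `tan t ^ 2`.
    have e1 : ∀ s ∈ Set.Ioi (0 : ℝ), (|(-2 : ℝ)| * s ^ ((-2 : ℝ) - 1)) •
        (1 / ((φ + s ^ (-2 : ℝ)) * rateShape (1 / 2) (s ^ (-2 : ℝ)))) =
          4 / ((1 + φ * s ^ 2) * (2 * s - 2 * Real.arctan s + Real.pi)) := fun s hs => by
      have hs0 : 0 < s := hs
      have hD : 2 * s - 2 * Real.arctan s + Real.pi ≠ 0 := by
        have := Real.arctan_lt_pi_div_two s
        exact ne_of_gt (by linarith)
      rw [rateShape_half hs0, Real.rpow_sub_one hs0.ne', Real.rpow_neg hs0.le, Real.rpow_two,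
        abs_neg, abs_two, smul_eq_mul]
      generalize 2 * s - 2 * Real.arctan s + Real.pi = D at *
      have : φ + (s ^ 2)⁻¹ = (1 + φ * s ^ 2) / s ^ 2 := by field_simp; ring
      rw [this]
      field_simp
      norm_num
    -- Uses `arctan (1 / s) = π / 2 - arctan s` for `s > 0`.
    have e2 : ∀ s ∈ Set.Ioi (0 : ℝ),
        4 / ((1 + φ * s ^ 2) * (2 * s - 2 * Real.arctan s + Real.pi)) =
          4 / (2 * (1 + φ * s ^ 2) * (s + Real.arctan (1 / s))) := fun s hs => by
      rw [one_div, Real.arctan_inv_of_pos hs]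
      ring_nf
    have hi : IntegrableOn (fun s : ℝ =>
        4 / ((1 + φ * s ^ 2) * (2 * s - 2 * Real.arctan s + Real.pi))) (Set.Ioi 0) :=
      ((integrableOn_Ioi_comp_rpow_iff _ (by norm_num : (-2 : ℝ) ≠ 0)).2 hK).congr_fun e1
        measurableSet_Ioi
    rw [← integral_comp_rpow_Ioi _ (by norm_num : (-2 : ℝ) ≠ 0),
      setIntegral_congr_fun measurableSet_Ioi e1] at hE
    exact ⟨hi, hE, hi.congr_fun e2 measurableSet_Ioi,
      hE.trans (by rw [setIntegral_congr_fun measurableSet_Ioi e2])⟩
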